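/- Let $S=\prod_p p^{\varepsilon_p}$, $\varepsilon_p\in\{0,1,\dots,\infty\}$, be a supernatural number with $\sum_p\varepsilon_p=\infty$, and let $\mathbb Z/S\mathbb Z=\prod_p \mathbb Z/p^{\varepsilon_p}\mathbb Z$ (with $\mathbb Z/p^\infty\mathbb Z=\mathbb Z_p$) be the compact $S$-adic ring, which contains $\mathbb Z$ via $k\mapsto (k \bmod p^{\varepsilon_p})_p$. Let $\{E_l\}_{l\in\mathbb Z}$ and $\{E_k^+\}_{k\ge 0}$ be the canonical bases of $H=\ell^2(\mathbb Z)$ and $H_+=\ell^2(\mathbb Z_{\ge 0})$; put $VE_l=E_{l+1}$ and, for $f\in C(\mathbb Z/S\mathbb Z)$, $m_fE_l=f(l)E_l$; let $B_S=C^*\{V,m_f\}$. Let $T(b)=P_{\ge0}\,b\,s$ be the Toeplitz map $B(H)\to B(H_+)$, where $sE_k^+=E_k$, $P_{\ge0}E_k=E_k^+$ for $k\ge0$ and $P_{\ge0}E_k=0$ for $k<0$. Write $\mathbb LE_l=lE_l$, $\mathbb KE^+_k=kE^+_k$, $\delta_{\mathbb L}(b)=[\mathbb L,b]$, $d_{\mathbb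 K}(c)=[\mathbb K,c]$. Let $B_S^\infty$ be the set of all $b=\sum_{n\in\mathbb Z}V^nm_{f_n}\in B_S$ such that $\{\|f_n\|\}$ is rapidly decaying and $V^lbV^{-l}=b$ for some positive integer $l$ dividing $S$. For each $l\mid S$ the subspace of those $b\in B_S^\infty$ with $V^lbV^{-l}=b$ carries the Fréchet topology of the norms $\|b\|_P=\sum_{j=0}^P\binom Pj\|\delta_{\mathbb L}^j(b)\|$, and $B_S^\infty$ carries the locally convex inductive limit (LF) topology of these subspaces. Let $\mathcal K^\infty$ be the set of all operators on $H_+$ whose matrix coefficients in the basis $\{E_k^+\}$ are rapidly decaying, with the Fréchet topology of the norms $\|c\|_{M,N}=\sum_{j=0}^M\binom Mj\|d_{\mathbb K}^j(c)(I+\mathbb K)^N\|$. Let $A_S^\infty=\{T(b)+c : b\in B_S^\infty,\ c\in\mathcal K^\infty\}$, topologized as $B_S^\infty\oplus\mathcal K^\infty$ via $(b,c)\mapsto T(b)+c$. **Theorem.** If $d:A_S^\infty\to\mathcal K^\infty$ is a continuous derivation (a continuous complex-linear map with $d(ab)=d(a)b+a\,d(b)$ for all $a,b\in A_S^\infty$),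 then there is $c\in\mathcal K^\infty$ such that $d(a)=[c,a]=ca-ac$ for every $a\in A_S^\infty$. In particular, $d$ is an inner derivation of $A_S^\infty$. -/

import Mathlib

open scoped ENNReal Topology

noncomputable section

namespace Odometer

/-! ### Supernatural numbers and the ring `ℤ/Sℤ` -/

/-- A supernatural number `∏ p ^ ε_p`, given by its exponents `ε_p ∈ {0, 1, …, ∞}`. -/
abbrev Supernatural : Type := Nat.Primes → ℕ∞

/-- `S` is infinite: `∑ ε_p = ∞` (the sum of exponents, as a supremum of finite partial sums). -/
def Supernatural.IsInfinite (S : Supernatural) : Prop :=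
  (⨆ F : Finset Nat.Primes, ∑ p ∈ F, S p) = ⊤

/-- The positive integer `l` divides the supernatural number `S`. -/
def Supernatural.DividedBy (S : Supernatural) (l : ℕ) : Prop :=
  l ≠ 0 ∧ ∀ p : Nat.Primes, (l.factorization p : ℕ∞) ≤ S p

instance primesFact (p : Nat.Primes) : Fact (p : ℕ).Prime := ⟨p.2⟩

/-- `ℤ/p^εℤ`, which is the ring of `p`-adic integers when `ε = ∞`. -/
def ModPrimePow (p : Nat.Primes) (e : ℕ∞) : Type :=
  match e with
  | ⊤ => ℤ_[(p : ℕ)]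
  | (n : ℕ) => ZMod ((p : ℕ) ^ n)

instance (p : Nat.Primes) (e : ℕ∞) : CommRing (ModPrimePow p e) :=
  match e with
  | ⊤ => inferInstanceAs (CommRing ℤ_[(p : ℕ)])
  | (n : ℕ) => inferInstanceAs (CommRing (ZMod ((p : ℕ) ^ n)))

/-- The `p`-adic topology for `ε = ∞`, the discrete topology for `ε < ∞`. -/
instance (p : Nat.Primes) (e : ℕ∞) : TopologicalSpace (ModPrimePow p e) :=
  match e with
  | ⊤ => inferInstanceAs (TopologicalSpace ℤ_[(p : ℕ)])
  | (n : ℕ) => inferInstanceAs (TopologicalSpace (ZMod ((p : ℕ) ^ n)))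

instance (p : Nat.Primes) (e : ℕ∞) : CompactSpace (ModPrimePow p e) :=
  match e with
  | ⊤ => inferInstanceAs (CompactSpace ℤ_[(p : ℕ)])
  | (n : ℕ) =>
    haveI : NeZero ((p : ℕ) ^ n) := ⟨pow_ne_zero n p.2.ne_zero⟩
    inferInstanceAs (CompactSpace (ZMod ((p : ℕ) ^ n)))

/-- The `S`-adic ring `ℤ/Sℤ = ∏_p ℤ/p^{ε_p}ℤ` with the product topology. The dense copy of `ℤ`
in it is the image of the canonical ring homomorphism `k ↦ (k : ZS S)`. -/
abbrev ZS (S : Supernatural) : Type := (p : Nat.Primes) → ModPrimePow p (S p)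

/-! ### Hilbert spaces and operators -/

/-- The Hilbert space `ℓ²(ι)`; the paper's `H` is `L2 ℤ` and `H₊` is `L2 ℕ`. -/
abbrev L2 (ι : Type) : Type := lp (fun _ : ι => ℂ) 2

/-- Bounded operators on `ℓ²(ι)`. -/
abbrev Op (ι : Type) : Type := L2 ι →L[ℂ] L2 ι

/-- The canonical basis vector `E_i`. -/
def basisVec {ι : Type} [DecidableEq ι] (i : ι) : L2 ι := lp.single 2 i (1 : ℂ)

/-- The matrix coefficient `⟨E_i, T E_j⟩`. -/
def entry {ι : Type} [DecidableEq ι] (T : Op ι) (i j : ι) : ℂ := T (basisVec j) i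

/-- The operator norm of the operator with the given matrix in the canonical basis; it is `∞` if
no bounded operator has this matrix. -/
def matrixNorm {ι : Type} [DecidableEq ι] (m : ι → ι → ℂ) : ℝ≥0∞ :=
  ⨅ (T : Op ι) (_ : ∀ i j, entry T i j = m i j), ‖T‖ₑ

theorem sum_sq_le {ι κ : Type} (x : L2 ι) (F : Finset κ) (σ : κ → ι)
    (hσ : Set.InjOn σ F) : ∑ k ∈ F, ‖x (σ k)‖ ^ 2 ≤ ‖x‖ ^ 2 := by
  classical
  have h := lp.sum_rpow_le_norm_rpow (p := 2) (by norm_num) x (F.image σ)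
  rw [Finset.sum_image hσ] at h
  simpa using h

/-- The bounded operator `ℓ²(ι) → ℓ²(κ)` given by a pointwise formula `g` with an `ℓ²` bound. -/
def mkOp {ι κ : Type} (g : (ι → ℂ) →ₗ[ℂ] (κ → ℂ)) (C : ℝ) (hC : 0 ≤ C)
    (h : ∀ (x : L2 ι) (F : Finset κ), ∑ k ∈ F, ‖g x k‖ ^ 2 ≤ (C * ‖x‖) ^ 2) :
    L2 ι →L[ℂ] L2 κ :=
  LinearMap.mkContinuous
    { toFun := fun x => ⟨g x, memℓp_gen' (C := (C * ‖x‖) ^ 2) (fun F => by simpa using h x F)⟩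
      map_add' := fun x y => by
        ext k
        exact congrFun (g.map_add x y) k
      map_smul' := fun c x => by
        ext k
        exact congrFun (g.map_smul c x) k } C (fun x => by
      refine lp.norm_le_of_forall_sum_le (by norm_num) (by positivity) (fun F => ?_)
      simpa using h x F)

/-- `V ^ n` for `n ∈ ℤ`, where `V E_l = E_{l+1}` is the bilateral shift:
`(V ^ n x)(k) = x (k - n)`. -/
def shift (n : ℤ) : Op ℤ :=
  mkOp
    { toFun := fun x k => x (k - n)
      map_add' := fun _ _ => rfl
      map_smul' := fun _ _ => rfl } 1 zero_le_one (fun x F => by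
    rw [one_mul]
    exact sum_sq_le x F (fun k => k - n) (fun a _ b _ hab => by simpa using hab))

/-- The multiplication operator `m_f` on `ℓ²(ℤ)`: `m_f E_l = f(l) E_l`. -/
def mulOp {S : Supernatural} (f : C(ZS S, ℂ)) : Op ℤ :=
  mkOp
    { toFun := fun x l => f (l : ZS S) * x l
      map_add' := fun x y => by ext l; simp [mul_add]
      map_smul' := fun c x => by ext l; simp [mul_left_comm] } ‖f‖ (norm_nonneg f) (fun x F => by
    calc ∑ l ∈ F, ‖f (l : ZS S) * x l‖ ^ 2 ≤ ∑ l ∈ F, ‖f‖ ^ 2 * ‖x l‖ ^ 2 := by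
          refine Finset.sum_le_sum (fun l _ => ?_)
          rw [norm_mul, mul_pow]
          gcongr
          exact f.norm_coe_le_norm _
      _ = ‖f‖ ^ 2 * ∑ l ∈ F, ‖x l‖ ^ 2 := by rw [Finset.mul_sum]
      _ ≤ ‖f‖ ^ 2 * ‖x‖ ^ 2 := by
          gcongr
          exact sum_sq_le x F id (Set.injOn_id _)
      _ = (‖f‖ * ‖x‖) ^ 2 := by rw [mul_pow])

/-- `P_{≥0} : H → H₊`, with `P_{≥0} E_k = E⁺_k` for `k ≥ 0` and `P_{≥0} E_k = 0` for `k < 0`. -/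
def restrictOp : L2 ℤ →L[ℂ] L2 ℕ :=
  mkOp
    { toFun := fun x k => x (k : ℤ)
      map_add' := fun _ _ => rfl
      map_smul' := fun _ _ => rfl } 1 zero_le_one (fun x F => by
    rw [one_mul]
    exact sum_sq_le x F (fun k : ℕ => (k : ℤ)) (fun a _ b _ hab => by simpa using hab))

/-- `s : H₊ → H`, with `s E⁺_k = E_k`. -/
def inclOp : L2 ℕ →L[ℂ] L2 ℤ :=
  mkOp
    { toFun := fun x k => if 0 ≤ k then x k.toNat else 0
      map_add' := fun x y => by ext k; by_cases hk : 0 ≤ k <;> simp [hk]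
      map_smul' := fun c x => by ext k; by_cases hk : 0 ≤ k <;> simp [hk] } 1 zero_le_one
    (fun x F => by
    rw [one_mul]
    calc ∑ k ∈ F, ‖if 0 ≤ k then x k.toNat else 0‖ ^ 2
        = ∑ k ∈ F with 0 ≤ k, ‖x k.toNat‖ ^ 2 := by
          rw [Finset.sum_filter]
          refine Finset.sum_congr rfl (fun k _ => ?_)
          by_cases hk : 0 ≤ k <;> simp [hk]
      _ ≤ ‖x‖ ^ 2 := by
          refine sum_sq_le x _ Int.toNat (fun a ha b hb hab => ?_)
          simp only [Finset.coe_filter, Set.mem_ofPred_eq] at ha hb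
          omega)

/-- The Toeplitz map `T(b) = P_{≥0} b s`. -/
def toeplitz : Op ℤ →ₗ[ℂ] Op ℕ where
  toFun b := restrictOp.comp (b.comp inclOp)
  map_add' b b' := by ext x; simp
  map_smul' c b := by ext x; simp

/-! ### The smooth Bunce-Deddens algebra -/

/-- The Bunce-Deddens algebra `B_S`, the C*-algebra generated by `V` and all `m_f`. -/
def BunceDeddens (S : Supernatural) : StarSubalgebra ℂ (Op ℤ) :=
  (StarAlgebra.adjoin ℂ ({shift 1} ∪ Set.range (mulOp (S := S)))).topologicalClosure

/-- A rapidly decaying family of numbers indexed by `ℤ`. -/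
def RapidDecay (a : ℤ → ℝ) : Prop :=
  ∀ N : ℕ, ∃ C : ℝ, ∀ n : ℤ, (1 + |(n : ℝ)|) ^ N * |a n| ≤ C

/-- The elements of `B_S^∞` of level `l`: elements `b = ∑ V^n m_{f_n}` of `B_S` for which
`{‖f_n‖}` is rapidly decaying and `V^l b V^{-l} = b`. -/
def smoothBDLevel (S : Supernatural) (l : ℕ) : Submodule ℂ (Op ℤ) where
  carrier := {b | b ∈ BunceDeddens S ∧
    (∃ f : ℤ → C(ZS S, ℂ), RapidDecay (fun n => ‖f n‖) ∧
      HasSum (fun n => shift n * mulOp (f n)) b) ∧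
    shift l * b * shift (-l) = b}
  add_mem' := by
    rintro b b' ⟨hb, ⟨f, hf, hfs⟩, hl⟩ ⟨hb', ⟨g, hg, hgs⟩, hl'⟩
    refine ⟨add_mem hb hb', ⟨fun n => f n + g n, fun N => ?_, ?_⟩, ?_⟩
    · obtain ⟨C, hC⟩ := hf N
      obtain ⟨D, hD⟩ := hg N
      refine ⟨C + D, fun n => le_trans ?_ (add_le_add (hC n) (hD n))⟩
      rw [← mul_add, abs_norm, abs_norm, abs_norm]
      gcongr
      exact norm_add_le _ _
    · convert hfs.add hgs using 2 with n
      rw [← mul_add]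
      congr 1
      ext x k
      exact add_mul _ _ _
    · rw [mul_add, add_mul, hl, hl']
  zero_mem' := by
    refine ⟨zero_mem _, ⟨fun _ => 0, fun N => ⟨0, fun n => by simp⟩, ?_⟩, by simp⟩
    convert (hasSum_zero : HasSum (fun _ : ℤ => (0 : Op ℤ)) 0) using 2 with n
    rw [show mulOp (0 : C(ZS S, ℂ)) = 0 from ?_, mul_zero]
    ext x k
    exact zero_mul _
  smul_mem' := by
    rintro c b ⟨hb, ⟨f, hf, hfs⟩, hl⟩
    refine ⟨SMulMemClass.smul_mem c hb, ⟨fun n => c • f n, fun N => ?_, ?_⟩, ?_⟩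
    · obtain ⟨C, hC⟩ := hf N
      refine ⟨‖c‖ * C, fun n => ?_⟩
      have := mul_le_mul_of_nonneg_left (hC n) (norm_nonneg c)
      rw [abs_norm] at this ⊢
      rw [norm_smul]
      linarith
    · convert hfs.const_smul c using 2 with n
      rw [← mul_smul_comm]
      congr 1
      ext x k
      exact mul_assoc _ _ _
    · rw [mul_smul_comm, smul_mul_assoc, hl]

theorem shift_mul (m n : ℤ) : shift m * shift n = shift (m + n) := by
  ext x k
  change x (k - m - n) = x (k - (m + n))
  rw [sub_sub]

theorem shift_period_mul {b : Op ℤ} {l : ℤ} (h : shift l * b * shift (-l) = b) (m : ℕ) :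
    shift (l * m) * b * shift (-(l * m)) = b := by
  induction m with
  | zero =>
    ext x k
    change (b (shift _ x)) (k - _) = _
    have : shift (-(l * ((0 : ℕ) : ℤ))) x = x := by
      ext j
      change x (j - _) = x j
      simp
    rw [this]
    simp
  | succ m ih =>
    have e1 : shift (l * ((m + 1 : ℕ) : ℤ)) = shift l * shift (l * m) := by
      rw [shift_mul]; congr 1; push_cast; ring
    have e2 : shift (-(l * ((m + 1 : ℕ) : ℤ))) = shift (-(l * m)) * shift (-l) := by
      rw [shift_mul]; congr 1; push_cast; ring
    calc _ = shift l * (shift (l * m) * b * shift (-(l * m))) * shift (-l) := by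
            rw [e1, e2]; simp only [mul_assoc]
      _ = b := by rw [ih, h]

theorem smoothBDLevel_mono (S : Supernatural) {l l' : ℕ} (h : l ∣ l') :
    smoothBDLevel S l ≤ smoothBDLevel S l' := by
  obtain ⟨m, rfl⟩ := h
  rintro b ⟨hb, hf, hl⟩
  refine ⟨hb, hf, ?_⟩
  have := shift_period_mul hl m
  push_cast
  exact this

theorem Supernatural.DividedBy.lcm {S : Supernatural} {l l' : ℕ} (h : S.DividedBy l)
    (h' : S.DividedBy l') : S.DividedBy (Nat.lcm l l') := by
  refine ⟨Nat.lcm_ne_zero h.1 h'.1, fun p => ?_⟩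
  rw [Nat.factorization_lcm h.1 h'.1, Finsupp.sup_apply]
  rcases le_total (l.factorization p) (l'.factorization p) with hp | hp
  · rw [sup_eq_right.2 hp]; exact h'.2 p
  · rw [sup_eq_left.2 hp]; exact h.2 p

theorem Supernatural.dividedBy_one (S : Supernatural) : S.DividedBy 1 :=
  ⟨one_ne_zero, fun p => by simp⟩

/-- The smooth Bunce-Deddens algebra `B_S^∞`. -/
def SmoothBD (S : Supernatural) : Submodule ℂ (Op ℤ) where
  carrier := {b | ∃ l : ℕ, S.DividedBy l ∧ b ∈ smoothBDLevel S l}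
  add_mem' := by
    rintro b b' ⟨l, hl, hb⟩ ⟨l', hl', hb'⟩
    exact ⟨_, hl.lcm hl', add_mem (smoothBDLevel_mono S (Nat.dvd_lcm_left l l') hb)
      (smoothBDLevel_mono S (Nat.dvd_lcm_right l l') hb')⟩
  zero_mem' := ⟨1, S.dividedBy_one, zero_mem _⟩
  smul_mem' := by
    rintro c b ⟨l, hl, hb⟩
    exact ⟨l, hl, Submodule.smul_mem _ c hb⟩

theorem smoothBDLevel_le {S : Supernatural} {l : ℕ} (hl : S.DividedBy l) :
    smoothBDLevel S l ≤ SmoothBD S := fun _ hb => ⟨l, hl, hb⟩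

/-- `‖b‖_P = ∑_{j ≤ P} (P choose j) ‖δ_𝕃^j(b)‖`. Here `δ_𝕃(b) = [𝕃, b]` with `𝕃 E_l = l E_l`, so
`δ_𝕃^j(b)` has the matrix coefficients `(k - l)^j ⟨E_k, b E_l⟩`. -/
def normBD (P : ℕ) (b : Op ℤ) : ℝ≥0∞ :=
  ∑ j ∈ Finset.range (P + 1),
    (P.choose j : ℝ≥0∞) * matrixNorm (fun k l : ℤ => ((k : ℂ) - (l : ℂ)) ^ j * entry b k l)

/-- The Fréchet topology of the level `l` subspace of `B_S^∞`: it is generated by the open balls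
of all the norms `‖·‖_P`. -/
abbrev topBDLevel (S : Supernatural) (l : ℕ) : TopologicalSpace (smoothBDLevel S l) :=
  TopologicalSpace.generateFrom
    {U | ∃ (b : smoothBDLevel S l) (P : ℕ) (ε : ℝ≥0∞), 0 < ε ∧
      U = {b' : smoothBDLevel S l | normBD P ((b' : Op ℤ) - (b : Op ℤ)) < ε}}

/-- The LF topology of `B_S^∞`, the locally convex inductive limit of its level `l` subspaces for
`l ∣ S`: it is the finest locally convex vector space topology for which all the inclusions of
these subspaces are continuous. -/
abbrev topBD (S : Supernatural) : TopologicalSpace (SmoothBD S) :=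
  sInf {t : TopologicalSpace (SmoothBD S) |
    @IsTopologicalAddGroup (SmoothBD S) t _ ∧
    @ContinuousSMul ℂ (SmoothBD S) _ _ t ∧
    @LocallyConvexSpace ℝ (SmoothBD S) _ _ _ _ t ∧
    ∀ (l : ℕ) (hl : S.DividedBy l),
      Continuous[topBDLevel S l, t] (Submodule.inclusion (smoothBDLevel_le hl))}

/-! ### Smooth compact operators -/

/-- The smooth compact operators `𝒦^∞` on `ℓ²(ℕ)`: the operators `c = ∑ c_{ks} P_{ks}` with
rapidly decaying matrix coefficients `c_{ks} = ⟨E_k, c E_s⟩`. -/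
def SmoothCompact : Submodule ℂ (Op ℕ) where
  carrier := {c | ∀ N : ℕ, ∃ C : ℝ, ∀ k s : ℕ,
    (1 + (k : ℝ) + (s : ℝ)) ^ N * ‖entry c k s‖ ≤ C}
  add_mem' := by
    intro c c' h h' N
    obtain ⟨C, hC⟩ := h N
    obtain ⟨D, hD⟩ := h' N
    refine ⟨C + D, fun k s => le_trans ?_ (add_le_add (hC k s) (hD k s))⟩
    rw [← mul_add]
    gcongr
    exact norm_add_le _ _
  zero_mem' := fun N => ⟨0, fun k s => by simp [entry]⟩
  smul_mem' := by
    intro a c h N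
    obtain ⟨C, hC⟩ := h N
    refine ⟨‖a‖ * C, fun k s => ?_⟩
    have h1 : ‖entry (a • c) k s‖ = ‖a‖ * ‖entry c k s‖ := norm_mul a (entry c k s)
    have h2 := mul_le_mul_of_nonneg_left (hC k s) (norm_nonneg a)
    rw [h1]
    linarith

/-- `‖c‖_{M,N} = ∑_{j ≤ M} (M choose j) ‖d_𝕂^j(c) (I + 𝕂)^N‖`. Here `d_𝕂(c) = [𝕂, c]` with
`𝕂 E_k = k E_k`, so `d_𝕂^j(c) (I + 𝕂)^N` has the matrix coefficients
`(k - s)^j ⟨E_k, c E_s⟩ (1 + s)^N`. -/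
def normCompact (M N : ℕ) (c : Op ℕ) : ℝ≥0∞ :=
  ∑ j ∈ Finset.range (M + 1), (M.choose j : ℝ≥0∞) *
    matrixNorm (fun k s : ℕ => ((k : ℂ) - (s : ℂ)) ^ j * entry c k s * (1 + (s : ℂ)) ^ N)

/-- The Fréchet topology of `𝒦^∞`: it is generated by the open balls of all the norms
`‖·‖_{M,N}`. -/
abbrev topCompact : TopologicalSpace SmoothCompact :=
  TopologicalSpace.generateFrom
    {U | ∃ (c : SmoothCompact) (M N : ℕ) (ε : ℝ≥0∞), 0 < ε ∧
      U = {c' : SmoothCompact | normCompact M N ((c' : Op ℕ) - (c : Op ℕ)) < ε}}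

/-! ### The smooth Bunce-Deddens-Toeplitz algebra -/

/-- `A_S^∞ = {T(b) + c : b ∈ B_S^∞, c ∈ 𝒦^∞}`. -/
def SmoothBDT (S : Supernatural) : Submodule ℂ (Op ℕ) :=
  (SmoothBD S).map toeplitz ⊔ SmoothCompact

/-- The identification `B_S^∞ ⊕ 𝒦^∞ → A_S^∞`, `(b, c) ↦ T(b) + c`. -/
def sumMap (S : Supernatural) (x : SmoothBD S × SmoothCompact) : SmoothBDT S :=
  ⟨toeplitz x.1 + x.2, Submodule.add_mem_sup (Submodule.mem_map_of_mem x.1.2) x.2.2⟩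

/-- The LF topology of `A_S^∞`: the topology of `B_S^∞ ⊕ 𝒦^∞` (the product topology),
transported by `(b, c) ↦ T(b) + c`. -/
abbrev topBDT (S : Supernatural) : TopologicalSpace (SmoothBDT S) :=
  TopologicalSpace.coinduced (sumMap S)
    (@instTopologicalSpaceProd _ _ (topBD S) topCompact)

theorem smoothCompact_le (S : Supernatural) : SmoothCompact ≤ SmoothBDT S := le_sup_right

/-- A linear map `d : A_S^∞ → 𝒦^∞` is a derivation: `d(ab) = d(a) b + a d(b)` in the algebra of
bounded operators, for `a`, `b` in the algebra `A_S^∞` (with product `ab ∈ A_S^∞`). -/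
def IsDerivation {S : Supernatural} (d : SmoothBDT S →ₗ[ℂ] SmoothCompact) : Prop :=
  ∀ a b ab : SmoothBDT S, (ab : Op ℕ) = (a : Op ℕ) * (b : Op ℕ) →
    (d ab : Op ℕ) = (d a : Op ℕ) * (b : Op ℕ) + (a : Op ℕ) * (d b : Op ℕ)

/-- `d` is inner: `d = [x, ·]` for some `x ∈ A_S^∞`. -/
def IsInner {S : Supernatural} (d : SmoothBDT S →ₗ[ℂ] SmoothCompact) : Prop :=
  ∃ x : SmoothBDT S, ∀ a : SmoothBDT S,
    (d a : Op ℕ) = (x : Op ℕ) * (a : Op ℕ) - (a : Op ℕ) * (x : Op ℕ)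

end Odometer

end

noncomputable section

namespace Odometer

/-! ### Matrix coefficients and matrix units -/

section Entries

variable {ι κ : Type} [DecidableEq ι]

/-! Write `P_{ks}` for the matrix units. If `d = [c, ·]`, then `d(P_{k0}) E_0 = c E_k - c_{00} E_k`,
so the matrix `G(i,k) = ⟨E_i, d(P_{k0}) E_0⟩` must be `c` up to a scalar. The proof takes `G` as the
definition and shows that some `G - γ I` is rapidly decaying.

Two families of generators control `G`. With `U` the unilateral shift, `U P_{k0} = P_{k+1,0}` makes
the increments of `G` along a diagonal into entries of `d(U)`, which decay rapidly; so each diagonal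
has a limit, approached at a rapid rate uniform in the diagonal. With `D` the diagonal operator of a
periodic `f`, `D P_{k0} = f(k) P_{k0}` gives `(f(k) - f(i)) G(i,k) = d(D)_{ik}`. As `S` is infinite,
for `i ≠ k` some prime power dividing `S` does not divide `k - i`; its residue function keeps
`f(k+m) - f(i+m)` away from `0`, so off-diagonal limits vanish. Only the main diagonal can have a
nonzero limit `γ`, and `c = G - γ I` lies in `𝒦^∞`.

Finally, applying `d` to `P_{0j} a P_{k0} = a_{jk} P_{00}` recovers every entry of `d(a)` as an
entry of `[c, a]`. -/

theorem basisVec_apply (i j : ι) : (basisVec i : L2 ι) j = if j = i then 1 else 0 := by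
  by_cases h : j = i
  · subst h; simp [basisVec]
  · simp [basisVec, h]

theorem norm_basisVec (i : ι) : ‖(basisVec i : L2 ι)‖ = 1 := by
  simp [basisVec, lp.norm_single]

theorem hasSum_apply_basisVec (A : L2 ι →L[ℂ] L2 κ) (x : L2 ι) (k : κ) :
    HasSum (fun j => x j * A (basisVec j) k) (A x k) := by
  have h := (lp.hasSum_single (by norm_num) x).mapL
    ((lp.evalCLM ℂ (fun _ : κ => ℂ) 2 k).comp A)
  convert! h using 2 with j
  have e : lp.single 2 j (x j) = x j • (basisVec j : L2 ι) := by
    rw [basisVec, ← lp.single_smul, smul_eq_mul, mul_one]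
  rw [e, map_smul]
  rfl

theorem op_ext {A B : Op ι} (h : ∀ i j, entry A i j = entry B i j) : A = B := by
  ext x k
  refine (hasSum_apply_basisVec A x k).unique ?_
  convert! hasSum_apply_basisVec B x k using 3 with j
  exact h k j

/-- Matrix coefficients as continuous functionals. -/
def entryCLM (i j : ι) : Op ι →L[ℂ] ℂ :=
  (lp.evalCLM ℂ (fun _ : ι => ℂ) 2 i).comp (ContinuousLinearMap.apply ℂ (L2 ι) (basisVec j))

theorem entryCLM_apply (T : Op ι) (i j : ι) : entryCLM i j T = entry T i j := rfl

theorem entry_add (A B : Op ι) (i j : ι) : entry (A + B) i j = entry A i j + entry B i j := rfl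

theorem entry_sub (A B : Op ι) (i j : ι) : entry (A - B) i j = entry A i j - entry B i j := rfl

theorem entry_smul (z : ℂ) (A : Op ι) (i j : ι) : entry (z • A) i j = z * entry A i j := rfl

/-- The matrix unit `E_s ↦ E_k`. -/
def matUnit (k s : ι) : Op ι :=
  (lp.evalCLM ℂ (fun _ : ι => ℂ) 2 s).smulRight (basisVec k)

theorem matUnit_apply (k s : ι) (x : L2 ι) : matUnit k s x = x s • (basisVec k : L2 ι) := rfl

theorem entry_matUnit (k s i j : ι) :
    entry (matUnit k s) i j = if i = k ∧ s = j then 1 else 0 := by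
  change (basisVec j : L2 ι) s * (basisVec k : L2 ι) i = _
  rw [basisVec_apply, basisVec_apply, ite_and]
  split_ifs <;> simp

theorem entry_mul_matUnit (A : Op ι) (k s i j : ι) :
    entry (A * matUnit k s) i j = if s = j then entry A i k else 0 := by
  change A ((basisVec j : L2 ι) s • (basisVec k : L2 ι)) i = _
  rw [map_smul, basisVec_apply]
  split_ifs
  · rw [one_smul]; rfl
  · rw [zero_smul]; rfl

theorem entry_matUnit_mul (A : Op ι) (k s i j : ι) :
    entry (matUnit k s * A) i j = if i = k then entry A s j else 0 := by
  change A (basisVec j) s * (basisVec k : L2 ι) i = _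
  rw [basisVec_apply]
  split_ifs
  · rw [mul_one]; rfl
  · rw [mul_zero]

theorem norm_matUnit_le (k s : ι) : ‖matUnit k s‖ ≤ 1 := by
  refine ContinuousLinearMap.opNorm_le_bound _ zero_le_one (fun x => ?_)
  rw [matUnit_apply, norm_smul, norm_basisVec, mul_one, one_mul]
  exact lp.norm_apply_le_norm (by norm_num) x s

/-- Compression isolates a single matrix coefficient, so a derivation applied to this identity
determines `d` entry by entry. -/
theorem matUnit_mul_mul_matUnit (A : Op ι) (i j k s : ι) :
    matUnit i j * (A * matUnit k s) = entry A j k • matUnit i s := by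
  refine op_ext fun a b => ?_
  rw [entry_matUnit_mul, entry_mul_matUnit, entry_smul, entry_matUnit]
  split_ifs <;> simp_all

end Entries

/-! ### Matrix coefficients of Toeplitz operators -/

theorem inclOp_basisVec (j : ℕ) : inclOp (basisVec j) = (basisVec (j : ℤ) : L2 ℤ) := by
  ext k
  change (if 0 ≤ k then (basisVec j : L2 ℕ) k.toNat else 0) = _
  rw [basisVec_apply, basisVec_apply]
  split_ifs <;> first | rfl | omega

theorem entry_toeplitz (b : Op ℤ) (i j : ℕ) : entry (toeplitz b) i j = entry b i j := by
  change (b (inclOp (basisVec j))) (i : ℤ) = _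
  rw [inclOp_basisVec]
  rfl

theorem entry_shift_mul_mulOp {S : Supernatural} (n : ℤ) (f : C(ZS S, ℂ)) (i j : ℤ) :
    entry (shift n * mulOp f) i j = if i - n = j then f (j : ZS S) else 0 := by
  change f ((i - n : ℤ) : ZS S) * (basisVec j : L2 ℤ) (i - n) = _
  rw [basisVec_apply]
  split_ifs with h
  · rw [h, mul_one]
  · rw [mul_zero]

/-! ### Rapidly decaying matrices -/

theorem matUnit_mem_smoothCompact (k s : ℕ) : matUnit k s ∈ SmoothCompact := by
  intro N
  refine ⟨(1 + (k : ℝ) + s) ^ N, fun i j => ?_⟩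
  rw [entry_matUnit]
  split_ifs with h
  · rw [h.1, h.2]; simp
  · simp; positivity

theorem summable_shifted_pow (a : ℝ) (ha : 0 < a) :
    Summable fun m : ℕ => ((a + m) ^ 2)⁻¹ := by
  have h : Summable fun m : ℕ => 1 / |(m : ℝ) + a| ^ (2 : ℝ) :=
    Real.summable_one_div_nat_add_rpow a 2 |>.2 (by norm_num)
  refine h.congr fun m => ?_
  rw [add_comm, abs_of_nonneg (by positivity)]
  norm_num

/-- The operator is the norm-convergent sum of the matrix units weighted by the entries. -/
theorem exists_smoothCompact_of_rapidDecay (m : ℕ → ℕ → ℂ)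
    (hm : ∀ N : ℕ, ∃ C : ℝ, ∀ k s : ℕ, (1 + (k : ℝ) + (s : ℝ)) ^ N * ‖m k s‖ ≤ C) :
    ∃ c : SmoothCompact, ∀ k s, entry (c : Op ℕ) k s = m k s := by
  -- Exponent 4 suffices for absolute convergence: `(1+k+s)^4` dominates `(1+k)^2 (1+s)^2`.
  obtain ⟨C, hC⟩ := hm 4
  have hsum : Summable fun q : ℕ × ℕ => m q.1 q.2 • matUnit q.1 q.2 := by
    have h1 : Summable fun m : ℕ => ((1 + (m : ℝ)) ^ 2)⁻¹ := summable_shifted_pow 1 one_pos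
    have h2 := (h1.mul_of_nonneg h1 (fun _ => by positivity) (fun _ => by positivity)).mul_left C
    refine Summable.of_norm_bounded h2 fun q => ?_
    have h3 : ‖m q.1 q.2 • matUnit q.1 q.2‖ ≤ ‖m q.1 q.2‖ := by
      rw [norm_smul]
      exact mul_le_of_le_one_right (norm_nonneg _) (norm_matUnit_le _ _)
    refine h3.trans ?_
    have h4 := hC q.1 q.2
    rw [← mul_inv, ← div_eq_mul_inv, le_div_iff₀ (by positivity), mul_comm]
    refine le_trans ?_ h4
    gcongr
    have a0 : (0 : ℝ) ≤ q.1 := by positivity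
    have b0 : (0 : ℝ) ≤ q.2 := by positivity
    calc (1 + (q.1 : ℝ)) ^ 2 * (1 + (q.2 : ℝ)) ^ 2
        ≤ (1 + (q.1 : ℝ) + q.2) ^ 2 * (1 + (q.1 : ℝ) + q.2) ^ 2 := by
          refine mul_le_mul (pow_le_pow_left₀ (by linarith) (by linarith) 2)
            (pow_le_pow_left₀ (by linarith) (by linarith) 2) (by positivity) (by positivity)
      _ = _ := by ring
  have hent : ∀ k s, entry (∑' q : ℕ × ℕ, m q.1 q.2 • matUnit q.1 q.2) k s = m k s := by
    intro k s
    have h1 := hsum.hasSum.mapL (entryCLM k s)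
    refine h1.unique ?_
    convert hasSum_ite_eq (k, s) (m k s) using 2 with q
    rw [entryCLM_apply, entry_smul, entry_matUnit]
    rcases q with ⟨a, b⟩
    by_cases h : (a, b) = (k, s)
    · cases h; simp
    · rw [if_neg h, if_neg, mul_zero]
      rintro ⟨rfl, rfl⟩
      exact h rfl
  refine ⟨⟨∑' q : ℕ × ℕ, m q.1 q.2 • matUnit q.1 q.2, fun N => ?_⟩, hent⟩
  obtain ⟨D, hD⟩ := hm N
  exact ⟨D, fun k s => by rw [hent]; exact hD k s⟩

/-- The columns of an operator of `A_S^∞` decay rapidly. -/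
theorem column_rapidDecay {S : Supernatural} {a : Op ℕ} (ha : a ∈ SmoothBDT S) (j N : ℕ) :
    ∃ C : ℝ, ∀ i : ℕ, (1 + (i : ℝ)) ^ N * ‖entry a i j‖ ≤ C := by
  obtain ⟨_, ⟨b, ⟨l, -, -, ⟨f, hf, hb⟩, -⟩, rfl⟩, c, hc, rfl⟩ := Submodule.mem_sup.1 ha
  obtain ⟨C, hC⟩ := hf N
  obtain ⟨D, hD⟩ := hc N
  refine ⟨(1 + (j : ℝ)) ^ N * C + D, fun i => ?_⟩
  have h1 : entry (toeplitz b) i j = f ((i : ℤ) - j) ((j : ℤ) : ZS S) := by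
    rw [entry_toeplitz]
    refine (hb.mapL (entryCLM (i : ℤ) (j : ℤ))).unique ?_
    convert hasSum_ite_eq ((i : ℤ) - j) (f ((i : ℤ) - j) ((j : ℤ) : ZS S)) using 2 with n
    rw [entryCLM_apply, entry_shift_mul_mulOp]
    by_cases h : n = (i : ℤ) - j
    · subst h; simp
    · rw [if_neg h, if_neg (by omega)]
  rw [entry_add, h1]
  -- With the column `j` fixed, this turns decay in the Fourier index `i - j` into decay in the row
  -- index `i`.
  have hi : (1 + (i : ℝ)) ≤ (1 + (j : ℝ)) * (1 + |(((i : ℤ) - j : ℤ) : ℝ)|) := by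
    push_cast
    have h2 : (i : ℝ) - j ≤ |(i : ℝ) - j| := le_abs_self _
    have h3 : 0 ≤ (j : ℝ) * |(i : ℝ) - j| := by positivity
    nlinarith
  have h4 : (1 + (i : ℝ)) ^ N * ‖f ((i : ℤ) - j) ((j : ℤ) : ZS S)‖ ≤ (1 + (j : ℝ)) ^ N * C := by
    calc (1 + (i : ℝ)) ^ N * ‖f ((i : ℤ) - j) ((j : ℤ) : ZS S)‖
        ≤ ((1 + (j : ℝ)) * (1 + |(((i : ℤ) - j : ℤ) : ℝ)|)) ^ N * ‖f ((i : ℤ) - j)‖ := by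
          gcongr
          exact (f _).norm_coe_le_norm _
      _ = (1 + (j : ℝ)) ^ N * ((1 + |(((i : ℤ) - j : ℤ) : ℝ)|) ^ N * |‖f ((i : ℤ) - j)‖|) := by
          rw [abs_norm, mul_pow, mul_assoc]
      _ ≤ _ := by gcongr; exact hC _
  have h5 : (1 + (i : ℝ)) ^ N * ‖entry c i j‖ ≤ D := by
    have h6 : (1 + (i : ℝ)) ≤ 1 + (i : ℝ) + j := le_add_of_nonneg_right (by positivity)
    exact le_trans (mul_le_mul_of_nonneg_right (pow_le_pow_left₀ (by positivity) h6 N)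
      (norm_nonneg _)) (hD i j)
  calc _ ≤ (1 + (i : ℝ)) ^ N * (‖f ((i : ℤ) - j) ((j : ℤ) : ZS S)‖ + ‖entry c i j‖) := by
        gcongr; exact norm_add_le _ _
    _ ≤ _ := by rw [mul_add]; exact add_le_add h4 h5

/-- The product has only column `s`, a copy of column `k` of `a`. Hence `d` can be applied to it
without knowing that `A_S^∞` is closed under all products. -/
theorem mul_matUnit_mem_smoothCompact {S : Supernatural} {a : Op ℕ} (ha : a ∈ SmoothBDT S)
    (k s : ℕ) : a * matUnit k s ∈ SmoothCompact := by
  intro N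
  obtain ⟨C, hC⟩ := column_rapidDecay ha k N
  have hC0 : 0 ≤ C := le_trans (by positivity) (hC 0)
  refine ⟨(1 + (s : ℝ)) ^ N * C, fun i j => ?_⟩
  rw [entry_mul_matUnit]
  split_ifs with h
  · subst h
    calc (1 + (i : ℝ) + s) ^ N * ‖entry a i k‖
        ≤ ((1 + (s : ℝ)) * (1 + i)) ^ N * ‖entry a i k‖ := by
          gcongr
          have : (0 : ℝ) ≤ s * i := by positivity
          linarith
      _ = (1 + (s : ℝ)) ^ N * ((1 + (i : ℝ)) ^ N * ‖entry a i k‖) := by rw [mul_pow, mul_assoc]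
      _ ≤ _ := by gcongr; exact hC i
  · simp; positivity

/-! ### Elements of the smooth Bunce-Deddens algebra -/

theorem toeplitz_shift_mul_mulOp_mem {S : Supernatural} {l : ℕ} (hl : S.DividedBy l) {n : ℤ}
    (hn : shift n ∈ BunceDeddens S) (f : C(ZS S, ℂ))
    (hf : ∀ k : ℤ, f ((k - l : ℤ) : ZS S) = f (k : ZS S)) :
    toeplitz (shift n * mulOp f) ∈ SmoothBDT S := by
  refine Submodule.mem_sup_left (Submodule.mem_map_of_mem ⟨l, hl, ?_, ?_, ?_⟩)
  · exact mul_mem hn (StarSubalgebra.le_topologicalClosure _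
      (StarAlgebra.subset_adjoin ℂ _ (Or.inr ⟨f, rfl⟩)))
  · refine ⟨Pi.single n f, fun N => ⟨(1 + |(n : ℝ)|) ^ N * ‖f‖, fun k => ?_⟩, ?_⟩
    · by_cases h : k = n
      · subst h; simp
      · simp only [Pi.single_eq_of_ne h, norm_zero, abs_zero, mul_zero]; positivity
    · have h0 : mulOp (0 : C(ZS S, ℂ)) = 0 := by
        ext x k
        exact zero_mul _
      convert! hasSum_ite_eq n (shift n * mulOp f) using 2 with k
      by_cases h : k = n
      · subst h; simp
      · rw [if_neg h, Pi.single_eq_of_ne h, h0, mul_zero]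
  · ext x k
    change f ((k - l - n : ℤ) : ZS S) * x (k - l - n - -l) = f ((k - n : ℤ) : ZS S) * x (k - n)
    rw [← hf (k - n), show k - l - n - -(l : ℤ) = k - n by ring,
      show k - l - n = k - n - (l : ℤ) by ring]

theorem toeplitz_shift_one_mem (S : Supernatural) :
    toeplitz (shift 1 * mulOp (1 : C(ZS S, ℂ))) ∈ SmoothBDT S :=
  toeplitz_shift_mul_mulOp_mem S.dividedBy_one
    (StarSubalgebra.le_topologicalClosure _ (StarAlgebra.subset_adjoin ℂ _ (Or.inl rfl))) 1
    (fun _ => rfl)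

theorem toeplitz_mulOp_mem {S : Supernatural} {l : ℕ} (hl : S.DividedBy l) (f : C(ZS S, ℂ))
    (hf : ∀ k : ℤ, f ((k - l : ℤ) : ZS S) = f (k : ZS S)) :
    toeplitz (shift 0 * mulOp f) ∈ SmoothBDT S := by
  refine toeplitz_shift_mul_mulOp_mem hl ?_ f hf
  convert! one_mem (BunceDeddens S)
  ext x k
  change x (k - 0) = x k
  rw [sub_zero]

/-! ### Residue functions and separation of integers -/

/-- Reduction modulo `p^e` is locally constant: trivially for finite exponent, and for `ℤ_p` because
its kernel is a ball around `0`. -/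
theorem exists_residue_function (p : Nat.Primes) (ε : ℕ∞) (e : ℕ) (he : (e : ℕ∞) ≤ ε) :
    ∃ f : C(ModPrimePow p ε, ℂ), ∀ k : ℤ,
      f (k : ModPrimePow p ε) = ((k : ZMod ((p : ℕ) ^ e)).val : ℂ) := by
  induction ε using ENat.recTopCoe with
  | top =>
    refine ⟨⟨fun x : ℤ_[(p : ℕ)] => ((PadicInt.toZModPow e x).val : ℂ), ?_⟩, fun k => ?_⟩
    · refine IsLocallyConstant.continuous ((IsLocallyConstant.iff_eventually_eq _).2
        fun x : ℤ_[(p : ℕ)] => ?_)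
      change ∀ᶠ y : ℤ_[(p : ℕ)] in 𝓝 x, _
      have hp : (0 : ℝ) < ((p : ℕ) : ℝ) ^ (-(e : ℤ)) := by
        have := p.2.pos
        positivity
      filter_upwards [Metric.ball_mem_nhds x hp] with y hy
      have h1 : ‖y - x‖ ≤ ((p : ℕ) : ℝ) ^ (-(e : ℤ)) := (mem_ball_iff_norm.1 hy).le
      rw [PadicInt.norm_le_pow_iff_mem_span_pow, ← PadicInt.ker_toZModPow, RingHom.mem_ker,
        map_sub, sub_eq_zero] at h1
      rw [h1]
    · change ((PadicInt.toZModPow e (k : ℤ_[(p : ℕ)])).val : ℂ) = _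
      rw [map_intCast]
  | coe n =>
    have hen : e ≤ n := by exact_mod_cast he
    refine ⟨⟨fun x : ZMod ((p : ℕ) ^ n) =>
      ((ZMod.castHom (pow_dvd_pow (p : ℕ) hen) (ZMod ((p : ℕ) ^ e)) x).val : ℂ), ?_⟩, fun k => ?_⟩
    · exact continuous_of_discreteTopology (α := ZMod ((p : ℕ) ^ n))
    · change ((ZMod.castHom (pow_dvd_pow (p : ℕ) hen) (ZMod ((p : ℕ) ^ e))
        (k : ZMod ((p : ℕ) ^ n))).val : ℂ) = _
      rw [map_intCast]

theorem dividedBy_prime_pow {S : Supernatural} {p : Nat.Primes} {e : ℕ} (he : (e : ℕ∞) ≤ S p) :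
    S.DividedBy ((p : ℕ) ^ e) := by
  refine ⟨pow_ne_zero _ p.2.ne_zero, fun q => ?_⟩
  rw [p.2.factorization_pow, Finsupp.single_apply]
  split_ifs with h
  · rwa [← Subtype.ext h]
  · simp

/-- Otherwise each exponent of `S` is at most that of the nonzero integer `n`, and the total
exponent is finite. -/
theorem Supernatural.IsInfinite.exists_prime_pow_not_dvd {S : Supernatural} (hS : S.IsInfinite)
    {n : ℤ} (hn : n ≠ 0) :
    ∃ (p : Nat.Primes) (e : ℕ), (e : ℕ∞) ≤ S p ∧ ¬ (((p : ℕ) ^ e : ℕ) : ℤ) ∣ n := by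
  by_contra! h
  have h1 : ∀ p : Nat.Primes, S p ≤ (n.natAbs.factorization p : ℕ∞) := fun p => by
    refine ENat.forall_natCast_le_iff_le.1 fun e he => ?_
    have := h p e he
    rw [Int.natCast_dvd, p.2.pow_dvd_iff_le_factorization (by simpa using hn)] at this
    exact_mod_cast this
  have h2 : (⨆ F : Finset Nat.Primes, ∑ p ∈ F, S p) ≤
      ((∑ q ∈ n.natAbs.primeFactors, n.natAbs.factorization q : ℕ) : ℕ∞) := by
    refine iSup_le fun F => (Finset.sum_le_sum fun p _ => h1 p).trans ?_
    rw [← Nat.cast_sum]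
    norm_cast
    let φ : Nat.Primes ↪ ℕ := ⟨fun p => (p : ℕ), fun _ _ h => Subtype.ext h⟩
    calc ∑ p ∈ F, n.natAbs.factorization (φ p)
        = ∑ q ∈ F.map φ, n.natAbs.factorization q :=
          (Finset.sum_map F φ (fun q => n.natAbs.factorization q)).symm
      _ ≤ _ := Finset.sum_le_sum_of_ne_zero fun q _ hq => by
          rw [← Nat.support_factorization]
          exact Finsupp.mem_support_iff.2 hq
  rw [Supernatural.IsInfinite] at hS
  rw [hS] at h2
  exact absurd h2 (by simp)

/-- If `i ≠ k`, some diagonal element of `A_S^∞` separates `i + m` and `k + m` for all `m`. -/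
theorem exists_separating_diagonal {S : Supernatural} (hS : S.IsInfinite) {i k : ℕ}
    (hik : i ≠ k) : ∃ f : C(ZS S, ℂ), toeplitz (shift 0 * mulOp f) ∈ SmoothBDT S ∧
      ∀ m : ℕ, 1 ≤ ‖f (((k + m : ℕ) : ℤ) : ZS S) - f (((i + m : ℕ) : ℤ) : ZS S)‖ := by
  obtain ⟨p, e, he, hd⟩ := hS.exists_prime_pow_not_dvd
    (n := (k : ℤ) - i) (sub_ne_zero.2 (by exact_mod_cast hik.symm))
  obtain ⟨g, hg⟩ := exists_residue_function p (S p) e he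
  have hval : ∀ j : ℤ, (g.comp ⟨fun x : ZS S => x p, continuous_apply p⟩) (j : ZS S) =
      ((j : ZMod ((p : ℕ) ^ e)).val : ℂ) := hg
  refine ⟨g.comp ⟨fun x : ZS S => x p, continuous_apply p⟩,
    toeplitz_mulOp_mem (dividedBy_prime_pow he) _ fun j => ?_, fun m => ?_⟩
  · rw [hval, hval]
    simp only [Int.cast_sub, Int.cast_natCast, ZMod.natCast_self, sub_zero]
  · rw [hval, hval]
    have : NeZero ((p : ℕ) ^ e) := ⟨pow_ne_zero e p.2.ne_zero⟩
    set u := (((k + m : ℕ) : ℤ) : ZMod ((p : ℕ) ^ e))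
    set v := (((i + m : ℕ) : ℤ) : ZMod ((p : ℕ) ^ e))
    -- Translation by `m` cancels in the difference, so the residues differ for every `m`; their
    -- integer representatives are then at least 1 apart.
    have huv : (u.val : ℤ) - v.val ≠ 0 := by
      intro h
      have h1 : u = v := ZMod.val_injective _ (by omega)
      have h2 := (ZMod.intCast_eq_intCast_iff_dvd_sub _ _ _).1 h1.symm
      refine hd ?_
      convert h2 using 1
      push_cast
      ring
    have h3 : (1 : ℝ) ≤ |(((u.val : ℤ) - v.val : ℤ) : ℝ)| := by
      exact_mod_cast Int.one_le_abs huv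
    have h4 : ((u.val : ℂ) - v.val) = ((((u.val : ℤ) - v.val : ℤ) : ℝ) : ℂ) := by push_cast; rfl
    rwa [h4, Complex.norm_real, Real.norm_eq_abs]

/-! ### Action of the generators on matrix units -/

theorem toeplitz_shift_mul_mulOp_apply {S : Supernatural} (n : ℤ) (f : C(ZS S, ℂ)) (x : L2 ℕ)
    (i : ℕ) : toeplitz (shift n * mulOp f) x i =
      f (((i : ℤ) - n : ℤ) : ZS S) * if 0 ≤ (i : ℤ) - n then x ((i : ℤ) - n).toNat else 0 :=
  rfl

theorem entry_toeplitz_shift_one_mul {S : Supernatural} (B : Op ℕ) (i j : ℕ) :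
    entry (toeplitz (shift 1 * mulOp (1 : C(ZS S, ℂ))) * B) (i + 1) j = entry B i j := by
  have h := toeplitz_shift_mul_mulOp_apply 1 (1 : C(ZS S, ℂ)) (B (basisVec j)) (i + 1)
  refine h.trans ?_
  rw [ContinuousMap.one_apply, one_mul, if_pos (by omega),
    show (((i + 1 : ℕ) : ℤ) - 1).toNat = i by omega]
  rfl

theorem entry_toeplitz_shift_one_mul_zero {S : Supernatural} (B : Op ℕ) (j : ℕ) :
    entry (toeplitz (shift 1 * mulOp (1 : C(ZS S, ℂ))) * B) 0 j = 0 := by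
  have h := toeplitz_shift_mul_mulOp_apply 1 (1 : C(ZS S, ℂ)) (B (basisVec j)) 0
  refine h.trans ?_
  rw [if_neg (by omega), mul_zero]

theorem toeplitz_shift_one_mul_matUnit (S : Supernatural) (k s : ℕ) :
    toeplitz (shift 1 * mulOp (1 : C(ZS S, ℂ))) * matUnit k s = matUnit (k + 1) s := by
  refine op_ext fun i j => ?_
  cases i with
  | zero => rw [entry_toeplitz_shift_one_mul_zero, entry_matUnit, if_neg (by omega)]
  | succ i =>
    rw [entry_toeplitz_shift_one_mul, entry_matUnit, entry_matUnit]
    simp only [Nat.add_right_cancel_iff]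

theorem entry_toeplitz_mulOp_mul {S : Supernatural} (f : C(ZS S, ℂ)) (B : Op ℕ) (i j : ℕ) :
    entry (toeplitz (shift 0 * mulOp f) * B) i j = f ((i : ℤ) : ZS S) * entry B i j := by
  have h := toeplitz_shift_mul_mulOp_apply 0 f (B (basisVec j)) i
  refine h.trans ?_
  rw [sub_zero, if_pos (by omega), Int.toNat_natCast]
  rfl

theorem toeplitz_mulOp_mul_matUnit {S : Supernatural} (f : C(ZS S, ℂ)) (k s : ℕ) :
    toeplitz (shift 0 * mulOp f) * matUnit k s = f ((k : ℤ) : ZS S) • matUnit k s := by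
  refine op_ext fun i j => ?_
  rw [entry_toeplitz_mulOp_mul, entry_smul, entry_matUnit]
  split_ifs with h
  · rw [h.1]
  · simp

/-! ### Derivations and matrix units -/

/-- The matrix unit as an element of `A_S^∞`. -/
def matUnitBDT (S : Supernatural) (k s : ℕ) : SmoothBDT S :=
  ⟨matUnit k s, smoothCompact_le S (matUnit_mem_smoothCompact k s)⟩

variable {S : Supernatural} {d : SmoothBDT S →ₗ[ℂ] SmoothCompact}

/-- The matrix of the operator `E_k ↦ d(P_{k0}) E_0`, which implements `d`. -/
def implementingMatrix (d : SmoothBDT S →ₗ[ℂ] SmoothCompact) (i k : ℕ) : ℂ :=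
  entry (d (matUnitBDT S k 0) : Op ℕ) i 0

/-- The Leibniz rule for the product `a P_{k0}`, read at entry `(i, 0)`. All relations for the
implementing matrix come from choices of `a`: the shift, a diagonal operator, or a matrix unit. -/
theorem IsDerivation.smul_implementingMatrix (hd : IsDerivation d) (a : SmoothBDT S) {z : ℂ}
    {k k' : ℕ} (h : (a : Op ℕ) * matUnit k 0 = z • matUnit k' 0) (i : ℕ) :
    z * implementingMatrix d i k' =
      entry (d a : Op ℕ) i k + entry ((a : Op ℕ) * (d (matUnitBDT S k 0) : Op ℕ)) i 0 := by
  have h1 := congrArg (fun T => entry T i 0) (hd a (matUnitBDT S k 0) (z • matUnitBDT S k' 0) h.symm)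
  rw [map_smul] at h1
  refine h1.trans ?_
  rw [entry_add]
  congr 1
  refine (entry_mul_matUnit _ _ _ _ _).trans (if_pos rfl)

theorem IsDerivation.implementingMatrix_succ (hd : IsDerivation d) (i k : ℕ) :
    implementingMatrix d (i + 1) (k + 1) =
      entry (d ⟨_, toeplitz_shift_one_mem S⟩ : Op ℕ) (i + 1) k + implementingMatrix d i k := by
  have h := hd.smul_implementingMatrix ⟨_, toeplitz_shift_one_mem S⟩ (z := 1)
    ((toeplitz_shift_one_mul_matUnit S k 0).trans (one_smul ℂ _).symm) (i + 1)
  rw [one_mul] at h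
  rw [h, implementingMatrix]
  congr 1
  exact entry_toeplitz_shift_one_mul _ _ _

theorem IsDerivation.sub_mul_implementingMatrix (hd : IsDerivation d) {f : C(ZS S, ℂ)}
    (hf : toeplitz (shift 0 * mulOp f) ∈ SmoothBDT S) (i k : ℕ) :
    (f ((k : ℤ) : ZS S) - f ((i : ℤ) : ZS S)) * implementingMatrix d i k =
      entry (d ⟨_, hf⟩ : Op ℕ) i k := by
  have h := hd.smul_implementingMatrix ⟨_, hf⟩ (toeplitz_mulOp_mul_matUnit f k 0) i
  rw [sub_mul, h, sub_eq_iff_eq_add]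
  congr 1

/-! ### Asymptotics along diagonals -/

theorem tendsto_entry_diagonal (c : SmoothCompact) (i k : ℕ) :
    Filter.Tendsto (fun m => entry (c : Op ℕ) (i + m) (k + m)) Filter.atTop (𝓝 0) := by
  obtain ⟨C, hC⟩ := c.2 1
  refine squeeze_zero_norm (a := fun m : ℕ => C * (1 / ((m : ℝ) + 1))) (fun m => ?_) ?_
  · rw [mul_one_div, le_div_iff₀ (by positivity), mul_comm]
    refine le_trans (mul_le_mul_of_nonneg_right ?_ (norm_nonneg _)) (hC (i + m) (k + m))
    have h0 : (0 : ℝ) ≤ i := by positivity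
    have h1 : (0 : ℝ) ≤ k := by positivity
    have h2 : (0 : ℝ) ≤ m := by positivity
    push_cast
    linarith
  · simpa using tendsto_one_div_add_atTop_nhds_zero_nat.const_mul C

/-- Along each diagonal the increments are the coefficients of `d(U)`, hence the deviation from
the limit is rapidly decaying, uniformly in the diagonal. -/
theorem IsDerivation.exists_implementingMatrix_bound (hd : IsDerivation d) (N : ℕ) :
    ∃ C : ℝ, ∀ (i k : ℕ) (L : ℂ),
      Filter.Tendsto (fun m => implementingMatrix d (i + m) (k + m)) Filter.atTop (𝓝 L) →
      (1 + (i : ℝ) + k) ^ N * ‖implementingMatrix d i k - L‖ ≤ C := by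
  -- Of the `N + 2` powers, `N` give the weight `(1+i+k)^N` and two make the increments summable in
  -- `m`.
  obtain ⟨C, hC⟩ := (d ⟨_, toeplitz_shift_one_mem S⟩).2 (N + 2)
  have hs := summable_shifted_pow 1 one_pos
  refine ⟨C * ∑' m : ℕ, ((1 + (m : ℝ)) ^ 2)⁻¹, fun i k L hL => ?_⟩
  have hP : 0 < (1 + (i : ℝ) + k) ^ N := by positivity
  have hstep : ∀ m : ℕ, dist (implementingMatrix d (i + m) (k + m))
      (implementingMatrix d (i + (m + 1)) (k + (m + 1))) ≤
      C / (1 + (i : ℝ) + k) ^ N * ((1 + (m : ℝ)) ^ 2)⁻¹ := by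
    intro m
    rw [← add_assoc, ← add_assoc, hd.implementingMatrix_succ, dist_eq_norm, sub_add_cancel_right,
      norm_neg, ← div_eq_mul_inv, div_div, le_div_iff₀ (by positivity), mul_comm]
    refine le_trans (mul_le_mul_of_nonneg_right ?_ (norm_nonneg _)) (hC (i + m + 1) (k + m))
    rw [pow_add]
    have h0 : (0 : ℝ) ≤ i := by positivity
    have h1 : (0 : ℝ) ≤ k := by positivity
    have h2 : (0 : ℝ) ≤ m := by positivity
    push_cast
    exact mul_le_mul (pow_le_pow_left₀ (by positivity) (by linarith) _)
      (pow_le_pow_left₀ (by positivity) (by linarith) _) (by positivity) (by positivity)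
  have h := dist_le_tsum_of_dist_le_of_tendsto₀ _ hstep (hs.mul_left _) hL
  rw [tsum_mul_left, add_zero, add_zero, dist_eq_norm, div_mul_eq_mul_div, le_div_iff₀ hP,
    mul_comm] at h
  exact h

/-- Quadratic decay of the entries of `d(U)` makes the main diagonal a Cauchy sequence. -/
theorem IsDerivation.exists_tendsto_implementingMatrix (hd : IsDerivation d) :
    ∃ γ : ℂ, Filter.Tendsto (fun m => implementingMatrix d m m) Filter.atTop (𝓝 γ) := by
  obtain ⟨C, hC⟩ := (d ⟨_, toeplitz_shift_one_mem S⟩).2 2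
  refine cauchySeq_tendsto_of_complete (cauchySeq_of_dist_le_of_summable
    (fun m : ℕ => C * ((1 + (m : ℝ)) ^ 2)⁻¹) (fun m => ?_)
    ((summable_shifted_pow 1 one_pos).mul_left C))
  rw [hd.implementingMatrix_succ, dist_eq_norm, sub_add_cancel_right, norm_neg, ← div_eq_mul_inv,
    le_div_iff₀ (by positivity), mul_comm]
  refine le_trans (mul_le_mul_of_nonneg_right ?_ (norm_nonneg _)) (hC (m + 1) m)
  have h2 : (0 : ℝ) ≤ m := by positivity
  push_cast
  exact pow_le_pow_left₀ (by positivity) (by linarith) _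

/-- The entries of `d(D)` tend to zero along the diagonal, while the factor `f(k+m) - f(i+m)` has
modulus at least 1 and can be divided out. -/
theorem IsDerivation.tendsto_implementingMatrix_of_ne (hd : IsDerivation d) (hS : S.IsInfinite)
    {i k : ℕ} (hik : i ≠ k) :
    Filter.Tendsto (fun m => implementingMatrix d (i + m) (k + m)) Filter.atTop (𝓝 0) := by
  obtain ⟨f, hf, hsep⟩ := exists_separating_diagonal hS hik
  refine squeeze_zero_norm (fun m => ?_)
    (tendsto_zero_iff_norm_tendsto_zero.1 (tendsto_entry_diagonal (d ⟨_, hf⟩) i k))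
  rw [← hd.sub_mul_implementingMatrix hf, norm_mul]
  exact le_mul_of_one_le_left (norm_nonneg _) (hsep m)

/-! ### The implementing element and the commutator identity -/

theorem IsDerivation.exists_entry_eq_implementingMatrix (hd : IsDerivation d)
    (hS : S.IsInfinite) : ∃ (γ : ℂ) (c : SmoothCompact), ∀ i k,
      entry (c : Op ℕ) i k = implementingMatrix d i k - if i = k then γ else 0 := by
  obtain ⟨γ, hγ⟩ := hd.exists_tendsto_implementingMatrix
  refine ⟨γ, exists_smoothCompact_of_rapidDecay _ fun N => ?_⟩
  obtain ⟨C, hC⟩ := hd.exists_implementingMatrix_bound N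
  refine ⟨C, fun i k => hC i k _ ?_⟩
  split_ifs with h
  · subst h
    simpa only [add_comm i] using (Filter.tendsto_add_atTop_iff_nat i).2 hγ
  · exact hd.tendsto_implementingMatrix_of_ne hS h

/-- A derivation (continuous or not) is the commutator with any operator of `𝒦^∞` which differs by a scalar from its
implementing matrix. -/
theorem IsDerivation.eq_commutator (hd : IsDerivation d) {γ : ℂ} {c : SmoothCompact}
    (hc : ∀ i k, entry (c : Op ℕ) i k = implementingMatrix d i k - if i = k then γ else 0)
    (a : SmoothBDT S) :
    (d a : Op ℕ) = (c : Op ℕ) * (a : Op ℕ) - (a : Op ℕ) * (c : Op ℕ) := by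
  have hcol : ∀ k, (d (matUnitBDT S k 0) : Op ℕ) * matUnit 0 0 =
      (c : Op ℕ) * matUnit k 0 + γ • matUnit k 0 := fun k => op_ext fun i j => by
    rw [entry_mul_matUnit, entry_add, entry_mul_matUnit, entry_smul, entry_matUnit, hc,
      implementingMatrix]
    split_ifs <;> simp_all
  -- This follows by differentiating `P_{0j} P_{s0} = δ_{js} P_{00}`, which expresses row 0 of
  -- `d(P_{0j})` through row `j` of the implementing matrix.
  have hrow : ∀ j, matUnit 0 0 * (d (matUnitBDT S 0 j) : Op ℕ) =
      (implementingMatrix d 0 0 - γ) • matUnit 0 j - matUnit 0 j * (c : Op ℕ) :=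
    fun j => op_ext fun i s => by
      have h := hd.smul_implementingMatrix (matUnitBDT S 0 j) (z := if j = s then 1 else 0)
        (k := s) (k' := 0) (op_ext fun a b => by
          refine (entry_matUnit_mul _ _ _ _ _).trans ?_
          rw [entry_matUnit, entry_smul, entry_matUnit]
          split_ifs <;> simp_all) 0
      have h' : entry ((matUnitBDT S 0 j : Op ℕ) * (d (matUnitBDT S s 0) : Op ℕ)) 0 0 =
          implementingMatrix d j s := (entry_matUnit_mul _ _ _ _ _).trans (if_pos rfl)
      rw [h'] at h
      rw [entry_matUnit_mul, entry_sub, entry_smul, entry_matUnit, entry_matUnit_mul, hc]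
      by_cases hi : i = 0
      · rw [if_pos hi, if_pos hi, eq_sub_of_add_eq h.symm]
        by_cases hs : j = s
        · subst hs; simp [hi]
        · simp [hs]
      · simp [hi]
  refine op_ext fun j k => ?_
  let b : SmoothBDT S := ⟨_, smoothCompact_le S (mul_matUnit_mem_smoothCompact a.2 k 0)⟩
  have h1 : (d b : Op ℕ) = _ := hd a (matUnitBDT S k 0) b rfl
  -- The Leibniz rule for `P_{0j} (a P_{k0}) = a_{jk} P_{00}`; with `h1` the right side contains
  -- `P_{0j} d(a) P_{k0}`, hence the entry `d(a)_{jk}`.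
  have h2 := hd (matUnitBDT S 0 j) b (entry (a : Op ℕ) j k • matUnitBDT S 0 0)
    (matUnit_mul_mul_matUnit _ _ _ _ _).symm
  rw [h1, map_smul] at h2
  have h3 : entry (a : Op ℕ) j k * implementingMatrix d 0 0 =
      entry ((d (matUnitBDT S 0 j) : Op ℕ) * ((a : Op ℕ) * matUnit k 0)) 0 0 +
      entry (matUnit 0 j * ((d a : Op ℕ) * matUnit k 0 +
        (a : Op ℕ) * (d (matUnitBDT S k 0) : Op ℕ))) 0 0 :=
    congrArg (fun T => entry T 0 0) h2
  have h4 : entry ((d (matUnitBDT S 0 j) : Op ℕ) * ((a : Op ℕ) * matUnit k 0)) 0 0 =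
      (implementingMatrix d 0 0 - γ) * entry (a : Op ℕ) j k -
        entry ((c : Op ℕ) * (a : Op ℕ)) j k := by
    rw [← (entry_matUnit_mul _ 0 0 0 0).trans (if_pos rfl), ← mul_assoc, hrow, sub_mul,
      smul_mul_assoc, entry_sub, entry_smul, entry_matUnit_mul, entry_mul_matUnit, mul_assoc,
      entry_matUnit_mul, ← mul_assoc, entry_mul_matUnit]
    simp only [if_true]
  have h5 : entry ((a : Op ℕ) * (d (matUnitBDT S k 0) : Op ℕ)) j 0 =
      entry ((a : Op ℕ) * (c : Op ℕ)) j k + γ * entry (a : Op ℕ) j k := by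
    rw [← (entry_mul_matUnit _ 0 0 j 0).trans (if_pos rfl), mul_assoc, hcol, mul_add,
      mul_smul_comm, entry_add, entry_smul, ← mul_assoc, entry_mul_matUnit, entry_mul_matUnit]
    simp only [if_true]
  rw [h4, entry_matUnit_mul, if_pos rfl, entry_add, entry_mul_matUnit, if_pos rfl, h5] at h3
  rw [entry_sub]
  -- The multiples of `a_{jk}` by `G(0,0)` and by `γ` cancel, leaving the commutator entry.
  linear_combination -h3

end Odometer

end

theorem mainTheorem2 (S : Odometer.Supernatural) (hS : S.IsInfinite)
    (d : Odometer.SmoothBDT S →ₗ[ℂ] Odometer.SmoothCompact)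
    (hcont : Continuous[Odometer.topBDT S, Odometer.topCompact] d)
    (hd : Odometer.IsDerivation d) :
    (∃ c : Odometer.SmoothCompact, ∀ a : Odometer.SmoothBDT S,
      (d a : Odometer.Op ℕ) =
        (c : Odometer.Op ℕ) * (a : Odometer.Op ℕ) - (a : Odometer.Op ℕ) * (c : Odometer.Op ℕ)) ∧
    Odometer.IsInner d := by
  obtain ⟨γ, c, hc⟩ := hd.exists_entry_eq_implementingMatrix hS
  exact ⟨⟨c, hd.eq_commutator hc⟩, ⟨c, Odometer.smoothCompact_le S c.2⟩, hd.eq_commutator hc⟩
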